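/- Let $d\ge 0$ and let $(X,\mathcal R)$, $\mathcal R=\{R_0,\dots,R_d\}$, be a (finite, symmetric) $d$-class association scheme with adjacency matrices $A_0=I,A_1,\dots,A_d$. Suppose it is $Q$-polynomial with respect to the ordering $E_0=\frac1{|X|}J,E_1,\dots,E_d$ of its primitive idempotents, i.e. for every $i$ there is a real polynomial $v_i^*$ of degree $i$ such that $|X|E_i$ is obtained by applying $v_i^*$ entrywise to $|X|E_1$. (The scheme with $d=0$, on one point, counts as $Q$-polynomial.) Let $C\subseteq X$ be non-empty with characteristic vector $\chi$. Put $S(C)=\{j : 1\le j\le d,\ \chi^TA_j\chi\ne 0\}$ and let $s=|S(C)|$ be the degree of $C$. For $0\le i\le d$ let $b_i=\frac{|X|}{|C|}\chi^TE_i\chi$, and let $F_i$ be the submatrix of $E_i$ with rows and columns indexed by $C$. Assume that there is $w^*\in\{0,1,\dots,d-s\}$ such that $b_{w^*}>0$ and $F_kF_l=0$ for all $k,l\in\{0,1,\dots,w^*+s\}$ with $|k-l|\ge w^*+1$. Then $(C,\mathcal R^C)$, where $\mathcal R^C=\{R_i\cap(C\times C) : i\in\{0\}\cup S(C)\}$,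 is a symmetric $s$-class association scheme, and it is $Q$-polynomial with respect to some ordering of its primitive idempotents. -/

import Mathlib

open scoped Matrix

namespace QScheme

noncomputable section

/-- `R 0, …, R d` are the relations of a symmetric `d`-class association scheme on `X`. -/
structure IsAssociationScheme {X : Type*} {d : ℕ} (R : Fin (d + 1) → X → X → Prop) : Prop where
  /-- every pair of points lies in exactly one relation -/
  existsUnique_rel : ∀ x y, ∃! i, R i x y
  /-- no relation is empty -/
  nonempty_rel : ∀ i, ∃ x y, R i x y
  /-- `R 0` is the diagonal -/
  rel_zero_iff : ∀ x y, R 0 x y ↔ x = y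
  symm_rel : ∀ i x y, R i x y → R i y x
  /-- existence of the intersection numbers `p i j k` -/
  exists_intersection_numbers : ∃ p : Fin (d + 1) → Fin (d + 1) → Fin (d + 1) → ℕ,
    ∀ i j k x y, R k x y → {z | R i x z ∧ R j z y}.ncard = p i j k

open Classical in
/-- The adjacency matrix of the relation `R i`. -/
def adj {X : Type*} {d : ℕ} (R : Fin (d + 1) → X → X → Prop) (i : Fin (d + 1)) : Matrix X X ℝ :=
  Matrix.of fun x y => if R i x y then 1 else 0

/-- The Bose-Mesner algebra, as the real linear span of the adjacency matrices. -/
def boseMesner {X : Type*} {d : ℕ} (R : Fin (d + 1) → X → X → Prop) :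
    Submodule ℝ (Matrix X X ℝ) :=
  Submodule.span ℝ (Set.range (adj R))

/-- `E 0, …, E d` is an ordering of the primitive idempotents of the Bose-Mesner algebra, starting
with `E 0 = J / |X|`. (For a `d`-class scheme the algebra has dimension `d + 1`, so that `d + 1`
nonzero, pairwise orthogonal idempotents in it are exactly its primitive idempotents.) -/
structure IsPrimitiveIdempotents {X : Type*} [Fintype X] [DecidableEq X] {d : ℕ}
    (R : Fin (d + 1) → X → X → Prop) (E : Fin (d + 1) → Matrix X X ℝ) : Prop where
  mem_boseMesner : ∀ i, E i ∈ boseMesner R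
  ne_zero : ∀ i, E i ≠ 0
  idem : ∀ i, E i * E i = E i
  orthogonal : ∀ i j, i ≠ j → E i * E j = 0
  sum_eq_one : ∑ i, E i = 1
  zero_apply : ∀ x y, E 0 x y = (Fintype.card X : ℝ)⁻¹

/-- `R` is a symmetric `d`-class association scheme on `X` that is `Q`-polynomial with respect to
the ordering `E 0, …, E d` of its primitive idempotents: for every `i` there is a polynomial of
degree `i` which, applied entrywise to `|X| E 1`, gives `|X| E i`.
(If `d = 0`, then `X` is a point, `(1 : Fin (0 + 1)) = 0`, and the condition holds trivially.) -/
structure IsQPolynomial {X : Type*} [Fintype X] [DecidableEq X] {d : ℕ}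
    (R : Fin (d + 1) → X → X → Prop) (E : Fin (d + 1) → Matrix X X ℝ) : Prop where
  isAssociationScheme : IsAssociationScheme R
  isPrimitiveIdempotents : IsPrimitiveIdempotents R E
  exists_polynomials : ∃ v : Fin (d + 1) → Polynomial ℝ, (∀ i, (v i).natDegree = (i : ℕ)) ∧
    ∀ i x y, (Fintype.card X : ℝ) * E i x y = (v i).eval ((Fintype.card X : ℝ) * E 1 x y)

/-- The characteristic vector of `C`. -/
def charVec {X : Type*} [DecidableEq X] (C : Finset X) : X → ℝ :=
  fun x => if x ∈ C then 1 else 0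

/-- The dual inner distribution `b i = |X| / |C| * χᵀ E_i χ` of `C`. -/
def dualInnerDistribution {X : Type*} [Fintype X] [DecidableEq X] {d : ℕ}
    (E : Fin (d + 1) → Matrix X X ℝ) (C : Finset X) (i : Fin (d + 1)) : ℝ :=
  (Fintype.card X : ℝ) / (C.card : ℝ) * (charVec C ⬝ᵥ (E i *ᵥ charVec C))

open Classical in
/-- The degree set of `C`: the indices `1 ≤ j ≤ d` with `χᵀ A_j χ ≠ 0`. -/
def degreeSet {X : Type*} [Fintype X] [DecidableEq X] {d : ℕ}
    (R : Fin (d + 1) → X → X → Prop) (C : Finset X) : Finset (Fin (d + 1)) :=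
  Finset.univ.filter fun j => j ≠ 0 ∧ charVec C ⬝ᵥ (adj R j *ᵥ charVec C) ≠ 0

/-- The degree `s` of `C`: the cardinality of its degree set. -/
def degree {X : Type*} [Fintype X] [DecidableEq X] {d : ℕ}
    (R : Fin (d + 1) → X → X → Prop) (C : Finset X) : ℕ :=
  (degreeSet R C).card

theorem card_insert_zero_degreeSet {X : Type*} [Fintype X] [DecidableEq X] {d : ℕ}
    (R : Fin (d + 1) → X → X → Prop) (C : Finset X) :
    (insert 0 (degreeSet R C)).card = degree R C + 1 := by
  rw [Finset.card_insert_of_notMem (by simp [degreeSet])]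
  rfl

/-- The family of relations induced on `C`: the restrictions to `C` of the `R i`, where `i` runs
(in increasing order) through `0` and the elements of the degree set of `C`. -/
def restrictedRel {X : Type*} [Fintype X] [DecidableEq X] {d : ℕ}
    (R : Fin (d + 1) → X → X → Prop) (C : Finset X) :
    Fin (degree R C + 1) → {x // x ∈ C} → {x // x ∈ C} → Prop :=
  fun j x y =>
    R ((insert 0 (degreeSet R C)).orderEmbOfFin (card_insert_zero_degreeSet R C) j) x.1 y.1

/-- The restricted idempotent `F k`: the submatrix of `E k` with rows and columns in `C`. -/
def restrictedIdempotent {X : Type*} {d : ℕ}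
    (E : Fin (d + 1) → Matrix X X ℝ) (C : Finset X) (k : Fin (d + 1)) :
    Matrix {x // x ∈ C} {x // x ∈ C} ℝ :=
  (E k).submatrix Subtype.val Subtype.val

end

end QScheme

namespace QScheme

/-! The span `𝒜` of the restricted adjacency matrices contains `1` and has dimension at most `s +
1`; what must be shown is that it is closed under products. By hypothesis `F k * F l = 0` for `k + w
< l`, while `F i * F (w + i) ≠ 0`, because `b w > 0` and an extreme Krein parameter is nonzero. So
for every `i ≤ s + 1` the matrices `F 0, …, F (i-1), F (w+i), …, F (w+s)` form a basis of `𝒜`, whose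
initial part annihilates its final part. The initial component `P i` of `1` is then the projection
onto the initial part, and the increments `G i = P (i+1) - P i` are `s + 1` orthogonal idempotents
with sum `1`. They span `𝒜`, which is therefore an algebra. Since `G i` lies in the span of `F 0, …,
F i` but not in that of `F 0, …, F (i-1)`, it is an entrywise polynomial of degree exactly `i` in
the restriction of `|X| E 1`; this is the `Q`-polynomial property. -/

/-- Vectors that are triangular with respect to a family of linear maps are independent. -/
theorem linearIndependent_of_triangular {ι V W : Type*} [LinearOrder ι] [Fintype ι]
    [AddCommGroup V] [Module ℝ V] [AddCommGroup W] [Module ℝ W]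
    (f : ι → V) (φ : ι → V →ₗ[ℝ] W) (hne : ∀ i, φ i (f i) ≠ 0)
    (hzero : ∀ i j, i < j → φ i (f j) = 0) : LinearIndependent ℝ f := by
  rw [Fintype.linearIndependent_iff]
  intro g hg i
  induction i using WellFoundedLT.induction with
  | ind i ih =>
    have h := congrArg (φ i) hg
    rw [map_sum, map_zero, Finset.sum_eq_single i] at h
    · rw [map_smul] at h
      exact (smul_eq_zero.mp h).resolve_right (hne i)
    · intro j _ hj
      rcases lt_or_gt_of_ne hj with hlt | hgt
      · simp [ih j hlt]
      · simp [hzero i j hgt]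
    · simp

theorem span_eq_of_linearIndependent {ι V : Type*} [Fintype ι] [AddCommGroup V] [Module ℝ V]
    [FiniteDimensional ℝ V] {S : Submodule ℝ V} {f : ι → V} (hf : LinearIndependent ℝ f)
    (hmem : ∀ i, f i ∈ S) (hdim : Module.finrank ℝ S ≤ Fintype.card ι) :
    Submodule.span ℝ (Set.range f) = S := by
  apply Submodule.eq_of_le_of_finrank_le
  · rw [Submodule.span_le]
    rintro _ ⟨i, rfl⟩
    exact hmem i
  · rwa [finrank_span_eq_card hf]

theorem eq_zero_of_isSymm_of_mul_self {n : Type*} [Fintype n] {M : Matrix n n ℝ}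
    (hs : Mᵀ = M) (h : M * M = 0) : M = 0 := by
  apply Matrix.conjTranspose_mul_self_eq_zero.mp
  rwa [Matrix.conjTranspose_eq_transpose_of_trivial, hs]

theorem transpose_eq_of_mem_span {n : Type*} {S : Set (Matrix n n ℝ)} (h : ∀ a ∈ S, aᵀ = a)
    {x : Matrix n n ℝ} (hx : x ∈ Submodule.span ℝ S) : xᵀ = x := by
  induction hx using Submodule.span_induction with
  | mem a ha => exact h a ha
  | zero => simp
  | add a b _ _ ha hb => simp [ha, hb]
  | smul c a _ ha => simp [ha]

/-! ### Orthogonal idempotents from a banded family of symmetric matrices. -/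

section Matrices

variable {n : Type*} [Fintype n] [DecidableEq n]

theorem linearIndependent_of_orthogonal_idempotents {ι : Type*} [Fintype ι] [LinearOrder ι]
    {G : ι → Matrix n n ℝ} (hne : ∀ i, G i ≠ 0) (hidem : ∀ i, G i * G i = G i)
    (horth : ∀ i j, i ≠ j → G i * G j = 0) : LinearIndependent ℝ G := by
  apply linearIndependent_of_triangular G (fun i => LinearMap.mulLeft ℝ (G i))
  · intro i
    simpa [hidem i] using hne i
  · intro i j hij
    simpa using horth i j hij.ne

theorem mul_eq_zero_of_mem_span {S T : Set (Matrix n n ℝ)} (h : ∀ a ∈ S, ∀ b ∈ T, a * b = 0)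
    {x y : Matrix n n ℝ} (hx : x ∈ Submodule.span ℝ S) (hy : y ∈ Submodule.span ℝ T) :
    x * y = 0 := by
  have h1 : Submodule.span ℝ T ≤ ⨅ a : S, LinearMap.ker (LinearMap.mulLeft ℝ (a : Matrix n n ℝ)) := by
    rw [Submodule.span_le]
    intro b hb
    simp only [SetLike.mem_coe, Submodule.mem_iInf, LinearMap.mem_ker, LinearMap.mulLeft_apply]
    exact fun a => h a a.2 b hb
  have h2 : Submodule.span ℝ S ≤ LinearMap.ker (LinearMap.mulRight ℝ y) := by
    rw [Submodule.span_le]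
    intro a ha
    have := (Submodule.mem_iInf _).mp (h1 hy) ⟨a, ha⟩
    simpa using this
  simpa using h2 hx

section Idempotents

variable {𝒜 : Submodule ℝ (Matrix n n ℝ)} {s w : ℕ} {F : ℕ → Matrix n n ℝ}

theorem mul_eq_zero_of_mem_span_initial_final
    (hzero : ∀ k l, l ≤ w + s → k + w < l → F k * F l = 0) (i : ℕ) {x y : Matrix n n ℝ}
    (hx : x ∈ Submodule.span ℝ (F '' Set.Iio i))
    (hy : y ∈ Submodule.span ℝ ((fun j => F (w + j)) '' Set.Icc i s)) : x * y = 0 := by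
  refine mul_eq_zero_of_mem_span ?_ hx hy
  rintro _ ⟨k, hk, rfl⟩ _ ⟨j, hj, rfl⟩
  simp only [Set.mem_Iio, Set.mem_Icc] at hk hj
  exact hzero _ _ (by omega) (by omega)

/-- The chosen `s + 1` matrices are independent: a relation puts a symmetric matrix in both the
initial and the final span, so its square is zero and it vanishes. By dimension they span `𝒜`, and
`1` splits accordingly. -/
theorem exists_decomposition_of_one (hdim : Module.finrank ℝ 𝒜 ≤ s + 1) (hone : 1 ∈ 𝒜)
    (hF : ∀ k ≤ w + s, F k ∈ 𝒜) (hsymm : ∀ k, (F k)ᵀ = F k)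
    (hzero : ∀ k l, l ≤ w + s → k + w < l → F k * F l = 0)
    (hne : ∀ i ≤ s, F i * F (w + i) ≠ 0) (i : ℕ) :
    ∃ P ∈ Submodule.span ℝ (F '' Set.Iio i),
      1 - P ∈ Submodule.span ℝ ((fun j => F (w + j)) '' Set.Icc i s) := by
  have hinit : LinearIndependent ℝ fun j : Fin (s + 1) => F j := by
    -- Right multiplication by `F (w + j)` kills the `F k` with `k < j`, so the system is triangular
    -- in the reversed order.
    have := linearIndependent_of_triangular (ι := (Fin (s + 1))ᵒᵈ)
      (fun j => F ((OrderDual.ofDual j : Fin (s + 1)) : ℕ))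
      (fun j => LinearMap.mulRight ℝ (F (w + (OrderDual.ofDual j : Fin (s + 1)))))
      (fun j => by simpa using hne _ (Nat.lt_succ_iff.mp (OrderDual.ofDual j : Fin (s + 1)).2))
      (fun j k hjk => by
        have h1 : (OrderDual.ofDual k : Fin (s + 1)) < OrderDual.ofDual j := hjk
        have h2 := (OrderDual.ofDual j : Fin (s + 1)).2
        rw [Fin.lt_def] at h1
        exact hzero _ _ (by omega) (by omega))
    exact this
  have hfin : LinearIndependent ℝ fun j : Fin (s + 1) => F (w + j) := by
    apply linearIndependent_of_triangular _ (fun j : Fin (s + 1) => LinearMap.mulLeft ℝ (F j))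
    · intro j
      simpa using hne _ (Nat.lt_succ_iff.mp j.2)
    · intro j k hjk
      rw [Fin.lt_def] at hjk
      exact hzero _ _ (by omega) (by omega)
  have hsplit : ∀ g : Fin (s + 1) → ℝ,
      ∑ j : Fin (s + 1), g j • (if (j : ℕ) < i then F j else F (w + j)) =
        (∑ j : Fin (s + 1), (if (j : ℕ) < i then g j else 0) • F j) +
          ∑ j : Fin (s + 1), (if (j : ℕ) < i then 0 else g j) • F (w + j) := by
    intro g
    rw [← Finset.sum_add_distrib]
    refine Finset.sum_congr rfl fun j _ => ?_
    split_ifs <;> simp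
  have hmemI : ∀ g : Fin (s + 1) → ℝ, (∑ j : Fin (s + 1), (if (j : ℕ) < i then g j else 0) • F j) ∈
      Submodule.span ℝ (F '' Set.Iio i) := by
    intro g
    refine Submodule.sum_mem _ fun j _ => ?_
    split_ifs with h
    · exact Submodule.smul_mem _ _ (Submodule.subset_span ⟨j, h, rfl⟩)
    · simp
  have hmemF : ∀ g : Fin (s + 1) → ℝ, (∑ j : Fin (s + 1), (if (j : ℕ) < i then 0 else g j) • F (w + j)) ∈
      Submodule.span ℝ ((fun j => F (w + j)) '' Set.Icc i s) := by
    intro g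
    refine Submodule.sum_mem _ fun j _ => ?_
    split_ifs with h
    · simp
    · exact Submodule.smul_mem _ _
        (Submodule.subset_span ⟨j, ⟨not_lt.mp h, Nat.lt_succ_iff.mp j.2⟩, rfl⟩)
  have hli : LinearIndependent ℝ fun j : Fin (s + 1) =>
      if (j : ℕ) < i then F j else F (w + j) := by
    rw [Fintype.linearIndependent_iff]
    intro g hg
    rw [hsplit] at hg
    have hM : (∑ j : Fin (s + 1), (if (j : ℕ) < i then g j else 0) • F j) = 0 := by
      refine eq_zero_of_isSymm_of_mul_self (transpose_eq_of_mem_span ?_ (hmemI g)) ?_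
      · rintro _ ⟨k, _, rfl⟩
        exact hsymm k
      · have h := mul_eq_zero_of_mem_span_initial_final hzero i (hmemI g) (hmemF g)
        rwa [eq_neg_of_add_eq_zero_right hg, mul_neg, neg_eq_zero] at h
    rw [hM, zero_add] at hg
    intro j
    have h1 := Fintype.linearIndependent_iff.mp hinit _ hM j
    have h2 := Fintype.linearIndependent_iff.mp hfin _ hg j
    by_cases h : (j : ℕ) < i
    · simpa [h] using h1
    · simpa [h] using h2
  have hspan := span_eq_of_linearIndependent (S := 𝒜) hli
    (fun j => by split_ifs <;> exact hF _ (by omega)) (by simpa using hdim)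
  rw [← hspan, Submodule.mem_span_range_iff_exists_fun] at hone
  obtain ⟨c, hc⟩ := hone
  rw [hsplit] at hc
  refine ⟨_, hmemI c, ?_⟩
  rw [← hc, add_sub_cancel_left]
  exact hmemF c

/-- Orthogonalization of a sequence of symmetric matrices `F 0, F 1, …` in an `(s + 1)`-dimensional
space of matrices, in which `F k * F l` vanishes for `k + w < l` but not for `k + w = l`. -/
theorem exists_orthogonal_idempotents (hdim : Module.finrank ℝ 𝒜 ≤ s + 1) (hone : 1 ∈ 𝒜)
    (hF : ∀ k ≤ w + s, F k ∈ 𝒜) (hsymm : ∀ k, (F k)ᵀ = F k)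
    (hzero : ∀ k l, l ≤ w + s → k + w < l → F k * F l = 0)
    (hne : ∀ i ≤ s, F i * F (w + i) ≠ 0) :
    ∃ G : ℕ → Matrix n n ℝ, (∀ i, G i ∈ Submodule.span ℝ (F '' Set.Iio (i + 1))) ∧
      (∀ i ≤ s, G i ∉ Submodule.span ℝ (F '' Set.Iio i)) ∧ (∀ i, G i * G i = G i) ∧
      (∀ i j, i ≠ j → G i * G j = 0) ∧ ∑ i ∈ Finset.range (s + 1), G i = 1 := by
  choose P hP hQ using exists_decomposition_of_one hdim hone hF hsymm hzero hne
  have hmono : ∀ {i j : ℕ}, i ≤ j → Submodule.span ℝ (F '' Set.Iio i) ≤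
      Submodule.span ℝ (F '' Set.Iio j) := fun h =>
    Submodule.span_mono (Set.image_mono (Set.Iio_subset_Iio h))
  -- `x * (1 - P j) = 0`, since `1 - P j` lies in the final span.
  have hinit : ∀ (j : ℕ) {x : Matrix n n ℝ}, x ∈ Submodule.span ℝ (F '' Set.Iio j) →
      x * P j = x := by
    intro j x hx
    have h := mul_eq_zero_of_mem_span_initial_final hzero j hx (hQ j)
    rw [mul_sub, mul_one, sub_eq_zero] at h
    exact h.symm
  have hPs : ∀ i, (P i)ᵀ = P i := fun i => transpose_eq_of_mem_span
    (by rintro _ ⟨k, _, rfl⟩; exact hsymm k) (hP i)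
  have hPP : ∀ {i j : ℕ}, i ≤ j → P i * P j = P i := fun h => hinit _ (hmono h (hP _))
  have hPP' : ∀ {i j : ℕ}, i ≤ j → P j * P i = P i := fun {i j} h => by
    have := congrArg Matrix.transpose (hPP h)
    rwa [Matrix.transpose_mul, hPs, hPs] at this
  have hidem : ∀ i, (P (i + 1) - P i) * (P (i + 1) - P i) = P (i + 1) - P i := fun i => by
    rw [sub_mul, mul_sub, mul_sub, hPP le_rfl, hPP le_rfl, hPP (Nat.le_succ i),
      hPP' (Nat.le_succ i)]
    abel
  refine ⟨fun i => P (i + 1) - P i, ?_, ?_, hidem, ?_, ?_⟩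
  · exact fun i => Submodule.sub_mem _ (hP _) (hmono (Nat.le_succ i) (hP i))
  -- Such a `G i` would lie in both the initial and the final span at `i`, so `G i = G i * G i = 0`
  -- and `P (i + 1) = P i`. Then `F i * F (w + i) = F i * P i * F (w + i) = 0`, a contradiction.
  · intro i hi hmem
    have hfinal : P (i + 1) - P i ∈
        Submodule.span ℝ ((fun j => F (w + j)) '' Set.Icc i s) := by
      have h1 := Submodule.sub_mem _ (hQ i) (Submodule.span_mono
        (Set.image_mono (Set.Icc_subset_Icc_left (Nat.le_succ i))) (hQ (i + 1)))
      rwa [sub_sub_sub_cancel_left] at h1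
    have h0 := mul_eq_zero_of_mem_span_initial_final hzero i hmem hfinal
    rw [hidem, sub_eq_zero] at h0
    have h1 : F i * P (i + 1) = F i :=
      hinit _ (Submodule.subset_span ⟨i, Nat.lt_succ_self i, rfl⟩)
    apply hne i hi
    rw [← h1, h0, mul_assoc, mul_eq_zero_of_mem_span_initial_final hzero i (hP i)
      (Submodule.subset_span ⟨i, ⟨le_rfl, hi⟩, rfl⟩), mul_zero]
  · intro i j hij
    rcases lt_or_gt_of_ne hij with h | h
    · rw [sub_mul, mul_sub, mul_sub, hPP (by omega), hPP (by omega), hPP (by omega),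
        hPP (by omega)]
      abel
    · rw [sub_mul, mul_sub, mul_sub, hPP' (by omega), hPP' (by omega), hPP' (by omega),
        hPP' (by omega)]
      abel
  · rw [Finset.sum_range_sub]
    -- At `0` the initial span is trivial; at `s + 1` the final one is.
    have h0 : P 0 = 0 := by simpa using hP 0
    have h1 : 1 - P (s + 1) = 0 := by simpa using hQ (s + 1)
    rw [h0, sub_zero, ← sub_eq_zero, ← neg_sub, h1, neg_zero]

end Idempotents

end Matrices

/-! ### The Bose-Mesner space as the matrices constant on relations. -/

section BoseMesner

variable {X : Type*} {d : ℕ} {R : Fin (d + 1) → X → X → Prop}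

theorem mem_boseMesner_iff (hR : ∀ x y, ∃! i, R i x y) {M : Matrix X X ℝ} :
    M ∈ boseMesner R ↔ ∃ m : Fin (d + 1) → ℝ, ∀ i x y, R i x y → M x y = m i := by
  have key : ∀ (m : Fin (d + 1) → ℝ) (i x y), R i x y → (∑ j, m j • adj R j) x y = m i := by
    intro m i x y hi
    rw [Matrix.sum_apply, Finset.sum_eq_single i]
    · simp [adj, hi]
    · intro j _ hj
      have : ¬ R j x y := fun h => hj ((hR x y).unique h hi)
      simp [adj, this]
    · simp
  rw [boseMesner, Submodule.mem_span_range_iff_exists_fun]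
  refine exists_congr fun m => ⟨?_, fun h => ?_⟩
  · rintro rfl
    exact key m
  · ext x y
    obtain ⟨i, hi, -⟩ := hR x y
    rw [key m i x y hi, h i x y hi]

theorem transpose_eq_of_mem_boseMesner (hs : ∀ i x y, R i x y → R i y x) {M : Matrix X X ℝ}
    (hM : M ∈ boseMesner R) : Mᵀ = M := by
  refine transpose_eq_of_mem_span ?_ hM
  rintro _ ⟨i, rfl⟩
  ext x y
  simp only [adj, Matrix.transpose_apply, Matrix.of_apply]
  congr 1
  exact propext ⟨hs i y x, hs i x y⟩

theorem hadamard_mem_boseMesner (hR : ∀ x y, ∃! i, R i x y) {M N : Matrix X X ℝ}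
    (hM : M ∈ boseMesner R) (hN : N ∈ boseMesner R) : M ⊙ N ∈ boseMesner R := by
  rw [mem_boseMesner_iff hR] at hM hN ⊢
  obtain ⟨m, hm⟩ := hM
  obtain ⟨k, hk⟩ := hN
  exact ⟨fun i => m i * k i, fun i x y h => by
    rw [Matrix.hadamard_apply, hm i x y h, hk i x y h]⟩

theorem finrank_boseMesner_le : Module.finrank ℝ (boseMesner R) ≤ d + 1 :=
  (finrank_range_le_card (R := ℝ) (adj R)).trans_eq (Fintype.card_fin _)

theorem one_mem_boseMesner [DecidableEq X] (h0 : ∀ x y, R 0 x y ↔ x = y) :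
    (1 : Matrix X X ℝ) ∈ boseMesner R := by
  have : (1 : Matrix X X ℝ) = adj R 0 := by
    ext x y
    simp [adj, h0, Matrix.one_apply]
  rw [this]
  exact Submodule.subset_span ⟨0, rfl⟩

theorem span_eq_boseMesner [Fintype X] [DecidableEq X] {G : Fin (d + 1) → Matrix X X ℝ}
    (hmem : ∀ i, G i ∈ boseMesner R) (hne : ∀ i, G i ≠ 0) (hidem : ∀ i, G i * G i = G i)
    (horth : ∀ i j, i ≠ j → G i * G j = 0) :
    Submodule.span ℝ (Set.range G) = boseMesner R :=
  span_eq_of_linearIndependent (linearIndependent_of_orthogonal_idempotents hne hidem horth) hmem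
    (by simpa using finrank_boseMesner_le)

/-- `d + 1` orthogonal nonzero idempotents are a basis, by dimension, and products of basis elements
stay in the space. -/
theorem mul_mem_boseMesner [Fintype X] [DecidableEq X] {G : Fin (d + 1) → Matrix X X ℝ}
    (hmem : ∀ i, G i ∈ boseMesner R) (hne : ∀ i, G i ≠ 0) (hidem : ∀ i, G i * G i = G i)
    (horth : ∀ i j, i ≠ j → G i * G j = 0) {M N : Matrix X X ℝ} (hM : M ∈ boseMesner R)
    (hN : N ∈ boseMesner R) : M * N ∈ boseMesner R := by
  rw [← span_eq_boseMesner hmem hne hidem horth, Submodule.mem_span_range_iff_exists_fun] at hM hN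
  obtain ⟨a, rfl⟩ := hM
  obtain ⟨b, rfl⟩ := hN
  rw [Finset.sum_mul_sum]
  refine Submodule.sum_mem _ fun i _ => Submodule.sum_mem _ fun j _ => ?_
  rw [smul_mul_assoc, mul_smul_comm]
  refine Submodule.smul_mem _ _ (Submodule.smul_mem _ _ ?_)
  by_cases h : i = j
  · rw [h, hidem]
    exact hmem j
  · rw [horth i j h]
    exact Submodule.zero_mem _

theorem adj_mul_adj_apply [Fintype X] (i j : Fin (d + 1)) (x y : X) :
    (adj R i * adj R j) x y = ({z | R i x z ∧ R j z y}.ncard : ℝ) := by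
  classical
  have : {z | R i x z ∧ R j z y} =
      ((Finset.univ.filter fun z => R i x z ∧ R j z y : Finset X) : Set X) := by
    ext z
    simp
  rw [this, Set.ncard_coe_finset, Finset.card_filter, Matrix.mul_apply]
  push_cast
  refine Finset.sum_congr rfl fun z _ => ?_
  by_cases h1 : R i x z <;> by_cases h2 : R j z y <;> simp [adj, h1, h2]

theorem exists_intersection_numbers_of_mul_mem [Fintype X] (hR : ∀ x y, ∃! i, R i x y)
    (hmul : ∀ i j, adj R i * adj R j ∈ boseMesner R) :
    ∃ p : Fin (d + 1) → Fin (d + 1) → Fin (d + 1) → ℕ,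
      ∀ i j k x y, R k x y → {z | R i x z ∧ R j z y}.ncard = p i j k := by
  choose m hm using fun i j => (mem_boseMesner_iff hR).mp (hmul i j)
  -- The real coefficients count points, so taking the floor loses nothing.
  refine ⟨fun i j k => ⌊m i j k⌋₊, fun i j k x y h => ?_⟩
  simp only [← hm i j k x y h, adj_mul_adj_apply, Nat.floor_natCast]

end BoseMesner

/-! ### Entrywise polynomials, degree against span. -/

section Polynomials

open Polynomial

variable {m : Type*}

/-- Entrywise evaluation of polynomials at the entries of a matrix. -/
def entrywiseEval (M : Matrix m m ℝ) : ℝ[X] →ₗ[ℝ] Matrix m m ℝ where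
  toFun p := Matrix.of fun x y => p.eval (M x y)
  map_add' p q := by ext; simp
  map_smul' c p := by ext; simp

@[simp]
theorem entrywiseEval_apply (M : Matrix m m ℝ) (p : ℝ[X]) (x y : m) :
    entrywiseEval M p x y = p.eval (M x y) := rfl

variable {M : Matrix m m ℝ} {u : ℕ → ℝ[X]} {F : ℕ → Matrix m m ℝ} {d : ℕ}

theorem entrywiseEval_mem_span (hu : ∀ k ≤ d, (u k).degree = k)
    (hF : ∀ k ≤ d, entrywiseEval M (u k) = F k) {n : ℕ} (hn : n ≤ d + 1) {p : ℝ[X]}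
    (hp : p.degree < n) : entrywiseEval M p ∈ Submodule.span ℝ (F '' Set.Iio n) := by
  induction n generalizing p with
  | zero =>
    have : p = 0 := by
      rw [← degree_eq_bot]
      simpa [Nat.WithBot.lt_zero_iff] using hp
    simp [this]
  | succ n ih =>
    have hd := hu n (by omega)
    have hne : (u n).coeff n ≠ 0 := coeff_ne_zero_of_eq_degree hd
    -- Cancel the coefficient of degree `n` with a multiple of `u n`.
    have hlt : (p - (p.coeff n / (u n).coeff n) • u n).degree < n := by
      rw [degree_lt_iff_coeff_zero] at hp ⊢
      intro k hk
      rcases hk.eq_or_lt with rfl | hk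
      · rw [coeff_sub, coeff_smul, smul_eq_mul, div_mul_cancel₀ _ hne, sub_self]
      · have : (u n).coeff k = 0 := coeff_eq_zero_of_degree_lt (by rw [hd]; exact_mod_cast hk)
        rw [coeff_sub, coeff_smul, this, hp k hk, smul_zero, sub_zero]
    have h1 := Submodule.span_mono (R := ℝ)
      (Set.image_mono (f := F) (Set.Iio_subset_Iio n.le_succ)) (ih (by omega) hlt)
    have h2 : F n ∈ Submodule.span ℝ (F '' Set.Iio (n + 1)) :=
      Submodule.subset_span ⟨n, Nat.lt_succ_self n, rfl⟩
    rw [map_sub, map_smul, hF n (by omega)] at h1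
    exact (Submodule.sub_mem_iff_left _ (Submodule.smul_mem _ _ h2)).mp h1

theorem exists_entrywiseEval_eq (hu : ∀ k ≤ d, (u k).degree = k)
    (hF : ∀ k ≤ d, entrywiseEval M (u k) = F k) {n : ℕ} (hn : n ≤ d + 1) {N : Matrix m m ℝ}
    (hN : N ∈ Submodule.span ℝ (F '' Set.Iio n)) :
    ∃ p : ℝ[X], p.degree < n ∧ entrywiseEval M p = N := by
  have h : Submodule.span ℝ (F '' Set.Iio n) ≤ (degreeLT ℝ n).map (entrywiseEval M) := by
    rw [Submodule.span_le]
    rintro _ ⟨k, hk, rfl⟩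
    rw [Set.mem_Iio] at hk
    refine ⟨u k, ?_, hF k (by omega)⟩
    rw [SetLike.mem_coe, mem_degreeLT, hu k (by omega)]
    exact_mod_cast hk
  obtain ⟨p, hp, rfl⟩ := h hN
  exact ⟨p, mem_degreeLT.mp hp, rfl⟩

/-- Reparametrization: matrices which are polynomials of degrees `0, 1, …, s` in `M` are, after
scaling, polynomials of these degrees in the one with index `1`. -/
theorem exists_polynomials_of_entrywiseEval {s : ℕ} {G : Fin (s + 1) → Matrix m m ℝ}
    {p : Fin (s + 1) → ℝ[X]} (hp : ∀ i, (p i).natDegree = i)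
    (hG : ∀ i, entrywiseEval M (p i) = G i) {N : ℝ} (hN : N ≠ 0) :
    ∃ v : Fin (s + 1) → ℝ[X], (∀ i, (v i).natDegree = (i : ℕ)) ∧
      ∀ i x y, N * G i x y = (v i).eval (N * G 1 x y) := by
  -- For `s = 0` the index `1` is `0` and everything is constant. Otherwise `p 1` is affine with
  -- nonzero slope, and its inverse is substituted.
  rcases s with _ | s
  · refine ⟨fun i => C N * p i, fun i => by rw [natDegree_C_mul hN, hp], fun i x y => ?_⟩
    have h0 : (p i).natDegree = 0 := by rw [hp]; omega
    have hconst : ∀ t, (p i).eval t = (p i).coeff 0 := fun t => by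
      conv_lhs => rw [eq_C_of_natDegree_eq_zero h0, eval_C]
    rw [← hG i, entrywiseEval_apply, eval_mul, eval_C, hconst, hconst]
  · have h1 : (p 1).natDegree = 1 := by simpa using hp 1
    obtain ⟨a, ha, b, hab⟩ := natDegree_eq_one.mp h1
    have hq : (C (N * a)⁻¹ * X + C (-b / a) : ℝ[X]).natDegree = 1 :=
      natDegree_linear (inv_ne_zero (mul_ne_zero hN ha))
    refine ⟨fun i => C N * (p i).comp (C (N * a)⁻¹ * X + C (-b / a)), fun i => ?_,
      fun i x y => ?_⟩
    · rw [natDegree_C_mul hN, natDegree_comp, hq, hp, mul_one]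
    · have h : (N * a)⁻¹ * (N * G 1 x y) + -b / a = M x y := by
        rw [← hG 1, entrywiseEval_apply, ← hab]
        simp only [eval_add, eval_mul, eval_C, eval_X]
        field_simp
        ring
      simp only [eval_mul, eval_C, eval_comp, eval_add, eval_X]
      rw [h, ← hG i, entrywiseEval_apply]

end Polynomials

section ExtendByZero

/-- Extension by zero of a finite sequence. -/
def extendByZero {α : Type*} [Zero α] {d : ℕ} (E : Fin (d + 1) → α) (k : ℕ) : α :=
  if h : k < d + 1 then E ⟨k, h⟩ else 0

variable {α : Type*} [Zero α] {d : ℕ} {E : Fin (d + 1) → α}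

theorem extendByZero_val (k : Fin (d + 1)) : extendByZero E k = E k :=
  dif_pos k.2

theorem extendByZero_of_le {k : ℕ} (hk : k ≤ d) :
    extendByZero E k = E ⟨k, Nat.lt_succ_of_le hk⟩ := by
  simp [extendByZero, Nat.lt_succ_of_le hk]

theorem extendByZero_of_lt {k : ℕ} (hk : d < k) : extendByZero E k = 0 :=
  dif_neg (by omega)

end ExtendByZero

/-! ### Nonvanishing of `F i * F (w + i)`. -/

section QPolynomial

open Polynomial

variable {X : Type*} [Fintype X] [DecidableEq X] {d : ℕ} {R : Fin (d + 1) → X → X → Prop}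
  {E : Fin (d + 1) → Matrix X X ℝ}

theorem IsQPolynomial.transpose_eq (hQ : IsQPolynomial R E) (k : Fin (d + 1)) :
    (E k)ᵀ = E k :=
  transpose_eq_of_mem_boseMesner hQ.isAssociationScheme.symm_rel
    (hQ.isPrimitiveIdempotents.mem_boseMesner k)

/-- `natDegree = 0` does not exclude the zero polynomial; `E k ≠ 0` does, so `degree` is also exact.
-/
theorem IsQPolynomial.exists_degree_eq (hQ : IsQPolynomial R E) :
    ∃ u : ℕ → ℝ[X], (∀ k ≤ d, (u k).degree = k) ∧
      ∀ k ≤ d, entrywiseEval ((Fintype.card X : ℝ) • E 1) (u k) = extendByZero E k := by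
  obtain ⟨v, hv, hev⟩ := hQ.exists_polynomials
  have hX : (Fintype.card X : ℝ) ≠ 0 := by
    obtain ⟨x, _⟩ := hQ.isAssociationScheme.nonempty_rel 0
    exact Nat.cast_ne_zero.mpr (@Fintype.card_ne_zero X _ ⟨x⟩)
  have hval : ∀ k, entrywiseEval ((Fintype.card X : ℝ) • E 1)
      (C (Fintype.card X : ℝ)⁻¹ * v k) = E k := by
    intro k
    ext x y
    simp only [entrywiseEval_apply, Matrix.smul_apply, smul_eq_mul, eval_mul, eval_C]
    rw [← hev, inv_mul_cancel_left₀ hX]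
  refine ⟨fun k => C (Fintype.card X : ℝ)⁻¹ * extendByZero v k, fun k hk => ?_, fun k hk => ?_⟩
  · simp only [extendByZero_of_le hk]
    have hne : v ⟨k, Nat.lt_succ_of_le hk⟩ ≠ 0 := by
      intro h0
      apply hQ.isPrimitiveIdempotents.ne_zero ⟨k, Nat.lt_succ_of_le hk⟩
      rw [← hval, h0, mul_zero, map_zero]
    rw [degree_C_mul (inv_ne_zero hX), degree_eq_natDegree hne, hv]
  · simp only [extendByZero_of_le hk]
    exact hval _

theorem trace_ne_zero_of_isSymm_of_idem {n : Type*} [Fintype n] {P : Matrix n n ℝ}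
    (hs : Pᵀ = P) (hi : P * P = P) (hne : P ≠ 0) : P.trace ≠ 0 := by
  intro h
  apply hne
  apply Matrix.trace_conjTranspose_mul_self_eq_zero_iff.mp
  rwa [Matrix.conjTranspose_eq_transpose_of_trivial, hs, hi]

/-- The extreme Krein parameter does not vanish. -/
theorem IsQPolynomial.trace_mul_hadamard_ne_zero (hQ : IsQPolynomial R E) {i w l : Fin (d + 1)}
    (hl : (l : ℕ) = w + i) : (E w * (E i ⊙ E l)).trace ≠ 0 := by
  obtain ⟨u, hu, hev⟩ := hQ.exists_degree_eq
  have hl' := l.2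
  have hI := hQ.isPrimitiveIdempotents
  have hdl := hu l (by omega)
  have hdwi : (u w * u i).degree = (l : ℕ) := by
    rw [degree_mul, hu w (by omega), hu i (by omega), hl]
    push_cast
    rfl
  have hlc : (u l).leadingCoeff ≠ 0 := by
    rw [leadingCoeff_ne_zero]
    rintro h
    rw [h, degree_zero] at hdl
    exact absurd hdl.symm (WithBot.natCast_ne_bot _)
  have hlc' : (u w * u i).leadingCoeff ≠ 0 := by
    rw [leadingCoeff_ne_zero]
    rintro h
    rw [h, degree_zero] at hdwi
    exact absurd hdwi.symm (WithBot.natCast_ne_bot _)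
  set c := (u w * u i).leadingCoeff / (u l).leadingCoeff with hc
  have hc0 : c ≠ 0 := div_ne_zero hlc' hlc
  -- Modulo the span of the `E k` with `k < l`, `E w ⊙ E i` is `c • E l`; hence the trace is `c`
  -- times that of `E l`.
  have hlt : (u w * u i - C c * u l).degree < (l : ℕ) := by
    rw [← hdwi]
    apply degree_sub_lt_left
    · rw [degree_C_mul hc0, hdl, hdwi]
    · rwa [← leadingCoeff_ne_zero]
    · rw [leadingCoeff_mul (C c), leadingCoeff_C, hc, div_mul_cancel₀ _ hlc]
  have hmem := entrywiseEval_mem_span hu hev (by omega) hlt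
  have hprod : entrywiseEval ((Fintype.card X : ℝ) • E 1) (u w * u i - C c * u l) =
      E w ⊙ E i - c • E l := by
    have h1 : E w ⊙ E i = entrywiseEval ((Fintype.card X : ℝ) • E 1) (u w * u i) := by
      ext x y
      rw [← extendByZero_val (E := E) w, ← extendByZero_val (E := E) i, ← hev w (by omega),
        ← hev i (by omega)]
      simp
    rw [map_sub, ← h1, ← smul_eq_C_mul, map_smul, hev l (by omega), extendByZero_val]
  rw [hprod] at hmem
  have h0 : (E w ⊙ E i - c • E l) * E l = 0 := by
    refine mul_eq_zero_of_mem_span (T := {E l}) ?_ hmem (Submodule.subset_span rfl)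
    rintro _ ⟨k, hk, rfl⟩ _ rfl
    rw [Set.mem_Iio] at hk
    rw [extendByZero_of_le (by omega)]
    exact hI.orthogonal _ _ (Fin.ne_of_lt hk)
  rw [sub_mul, smul_mul_assoc, hI.idem, sub_eq_zero] at h0
  have htr : (E w * (E i ⊙ E l)).trace = ((E w ⊙ E i) * E l).trace := by
    simp only [Matrix.trace, Matrix.diag_apply, Matrix.mul_apply, Matrix.hadamard_apply]
    refine Finset.sum_congr rfl fun x _ => Finset.sum_congr rfl fun y _ => ?_
    have : E i y x = E i x y := congrFun (congrFun (hQ.transpose_eq i) x) y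
    rw [this, mul_assoc]
  rw [htr, h0, Matrix.trace_smul, smul_eq_mul]
  exact mul_ne_zero hc0
    (trace_ne_zero_of_isSymm_of_idem (hQ.transpose_eq l) (hI.idem l) (hI.ne_zero l))

/-- With `D` the diagonal matrix of `C` and `N = E i * D * E l`, the trace of `Nᵀ * N` is that of `D
* E i * D * E l`, whose diagonal on `C` is that of `F i * F l`. -/
theorem IsQPolynomial.mul_diagonal_mul_eq_zero (hQ : IsQPolynomial R E) (C : Finset X)
    {i l : Fin (d + 1)} (h : restrictedIdempotent E C i * restrictedIdempotent E C l = 0) :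
    E i * Matrix.diagonal (charVec C) * E l = 0 := by
  have hI := hQ.isPrimitiveIdempotents
  set D := Matrix.diagonal (charVec C) with hD
  apply Matrix.trace_conjTranspose_mul_self_eq_zero_iff.mp
  have hT : (E i * D * E l)ᵀ = E l * D * E i := by
    rw [Matrix.transpose_mul, Matrix.transpose_mul, hQ.transpose_eq, hQ.transpose_eq,
      Matrix.diagonal_transpose, mul_assoc]
  have h1 : E l * D * E i * (E i * D * E l) = E l * (D * (E i * (D * E l))) := by
    simp only [mul_assoc]
    rw [← mul_assoc (E i) (E i), hI.idem]
  have h2 : D * (E i * (D * E l)) * E l = D * (E i * (D * E l)) := by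
    simp only [mul_assoc, hI.idem]
  rw [Matrix.conjTranspose_eq_transpose_of_trivial, hT, h1, Matrix.trace_mul_comm, h2]
  simp only [Matrix.trace, Matrix.diag_apply]
  refine Finset.sum_eq_zero fun x _ => ?_
  rw [hD, Matrix.diagonal_mul]
  by_cases hx : x ∈ C
  · have hxx := congrFun (congrFun h ⟨x, hx⟩) ⟨x, hx⟩
    rw [Matrix.mul_apply] at hxx
    simp only [restrictedIdempotent, Matrix.submatrix_apply, Matrix.zero_apply] at hxx
    rw [Finset.sum_coe_sort C fun z => E i x z * E l z x] at hxx
    rw [Matrix.mul_apply]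
    simp only [Matrix.diagonal_mul, charVec, hx, if_true, one_mul, ite_mul, zero_mul, mul_ite,
      mul_zero, Finset.sum_ite_mem, Finset.univ_inter]
    exact hxx
  · simp [charVec, hx]

/-- If the product vanished, so would the diagonal of `E i * D * E l`, which is `(E i ⊙ E l) χ`.
Multiplying by `E w` gives a nonzero Krein coefficient times `E w χ`, so `b w = 0`. -/
theorem IsQPolynomial.restrictedIdempotent_mul_ne_zero (hQ : IsQPolynomial R E) {C : Finset X}
    {i w l : Fin (d + 1)} (hl : (l : ℕ) = w + i) (hb : 0 < dualInnerDistribution E C w) :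
    restrictedIdempotent E C i * restrictedIdempotent E C l ≠ 0 := by
  intro h
  have hI := hQ.isPrimitiveIdempotents
  have hN := hQ.mul_diagonal_mul_eq_zero C h
  have hM : (E i ⊙ E l) *ᵥ charVec C = 0 := by
    ext a
    have ha := congrFun (congrFun hN a) a
    rw [Matrix.mul_apply] at ha
    refine Eq.trans ?_ ha
    rw [Matrix.mulVec, dotProduct]
    refine Finset.sum_congr rfl fun x _ => ?_
    have : E l x a = E l a x := congrFun (congrFun (hQ.transpose_eq l) a) x
    rw [Matrix.mul_diagonal, Matrix.hadamard_apply, this]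
    ring
  have hmem := hadamard_mem_boseMesner hQ.isAssociationScheme.existsUnique_rel
    (hI.mem_boseMesner i) (hI.mem_boseMesner l)
  rw [← span_eq_boseMesner hI.mem_boseMesner hI.ne_zero hI.idem hI.orthogonal,
    Submodule.mem_span_range_iff_exists_fun] at hmem
  obtain ⟨q, hq⟩ := hmem
  have hEM : E w * (E i ⊙ E l) = q w • E w := by
    rw [← hq, Finset.mul_sum, Finset.sum_eq_single w]
    · rw [mul_smul_comm, hI.idem]
    · intro k _ hk
      rw [mul_smul_comm, hI.orthogonal w k hk.symm, smul_zero]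
    · simp
  have hqw : q w ≠ 0 := by
    intro h0
    apply hQ.trace_mul_hadamard_ne_zero hl
    rw [hEM, h0, zero_smul, Matrix.trace_zero]
  have hw0 : E w *ᵥ charVec C = 0 := by
    have := congrArg (E w *ᵥ ·) hM
    simp only [Matrix.mulVec_mulVec, hEM, Matrix.mulVec_zero, Matrix.smul_mulVec] at this
    exact (smul_eq_zero.mp this).resolve_left hqw
  rw [dualInnerDistribution, hw0, dotProduct_zero, mul_zero] at hb
  exact lt_irrefl _ hb

end QPolynomial

/-! ### The relations induced on `C`. -/

section Restriction

variable {X : Type*} [Fintype X] [DecidableEq X] {d : ℕ} {R : Fin (d + 1) → X → X → Prop}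
  {C : Finset X}

theorem charVec_dotProduct_adj (j : Fin (d + 1)) :
    charVec C ⬝ᵥ (adj R j *ᵥ charVec C) = ∑ x ∈ C, ∑ y ∈ C, adj R j x y := by
  simp [dotProduct, Matrix.mulVec, charVec]

/-- Adjacency entries are nonnegative, so their sum over `C × C` vanishes only termwise. -/
theorem mem_degreeSet {j : Fin (d + 1)} :
    j ∈ degreeSet R C ↔ j ≠ 0 ∧ ∃ x ∈ C, ∃ y ∈ C, R j x y := by
  classical
  have hnn : ∀ x y, 0 ≤ adj R j x y := fun x y => by
    rw [adj, Matrix.of_apply]; split_ifs <;> norm_num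
  have hsum : ∑ x ∈ C, ∑ y ∈ C, adj R j x y = 0 ↔ ∀ x ∈ C, ∀ y ∈ C, adj R j x y = 0 := by
    rw [Finset.sum_eq_zero_iff_of_nonneg fun x _ => Finset.sum_nonneg fun y _ => hnn x y]
    exact forall₂_congr fun x _ => Finset.sum_eq_zero_iff_of_nonneg fun y _ => hnn x y
  rw [degreeSet, Finset.mem_filter, charVec_dotProduct_adj]
  simp only [ne_eq, hsum]
  simp [adj]

theorem degree_le : degree R C ≤ d := by
  have := (insert 0 (degreeSet R C)).card_le_univ
  rw [card_insert_zero_degreeSet] at this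
  simpa using this

theorem restrictedRel_existsUnique (hR : IsAssociationScheme R) (x y : {x // x ∈ C}) :
    ∃! i, restrictedRel R C i x y := by
  obtain ⟨j, hj, hju⟩ := hR.existsUnique_rel x y
  have hmem : j ∈ insert 0 (degreeSet R C) := by
    rw [Finset.mem_insert, mem_degreeSet]
    by_cases h : j = 0
    · exact Or.inl h
    · exact Or.inr ⟨h, x, x.2, y, y.2, hj⟩
  rw [← Finset.mem_coe, ← Finset.range_orderEmbOfFin _ (card_insert_zero_degreeSet R C)] at hmem
  obtain ⟨i, rfl⟩ := hmem
  exact ⟨i, hj, fun k hk => (RelEmbedding.injective _) (hju _ hk)⟩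

theorem orderEmbOfFin_insert_zero_degreeSet :
    (insert 0 (degreeSet R C)).orderEmbOfFin (card_insert_zero_degreeSet R C) 0 = 0 := by
  have h := Finset.orderEmbOfFin_zero (card_insert_zero_degreeSet R C) (Nat.succ_pos _)
  exact h.trans (le_antisymm (Finset.min'_le _ _ (Finset.mem_insert_self _ _)) (Fin.zero_le _))

theorem restrictedRel_zero_iff (hR : IsAssociationScheme R) (x y : {x // x ∈ C}) :
    restrictedRel R C 0 x y ↔ x = y := by
  rw [restrictedRel, orderEmbOfFin_insert_zero_degreeSet, hR.rel_zero_iff, Subtype.ext_iff]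

theorem restrictedRel_nonempty (hR : IsAssociationScheme R) (hC : C.Nonempty)
    (i : Fin (degree R C + 1)) : ∃ x y, restrictedRel R C i x y := by
  have hmem := Finset.orderEmbOfFin_mem _ (card_insert_zero_degreeSet R C) i
  rw [Finset.mem_insert, mem_degreeSet] at hmem
  rcases hmem with h | ⟨-, x, hx, y, hy, h⟩
  · obtain ⟨x, hx⟩ := hC
    exact ⟨⟨x, hx⟩, ⟨x, hx⟩, by rw [restrictedRel, h, hR.rel_zero_iff]⟩
  · exact ⟨⟨x, hx⟩, ⟨y, hy⟩, h⟩

theorem submatrix_mem_boseMesner (hR : IsAssociationScheme R) {M : Matrix X X ℝ}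
    (hM : M ∈ boseMesner R) :
    M.submatrix Subtype.val Subtype.val ∈ boseMesner (restrictedRel R C) := by
  rw [mem_boseMesner_iff hR.existsUnique_rel] at hM
  rw [mem_boseMesner_iff (restrictedRel_existsUnique hR)]
  obtain ⟨m, hm⟩ := hM
  exact ⟨_, fun i x y h => hm _ _ _ h⟩

end Restriction

end QScheme

/-! ### The induced scheme and its `Q`-polynomial structure. -/

theorem theorem3 {X : Type*} [Fintype X] [DecidableEq X] {d : ℕ}
    (R : Fin (d + 1) → X → X → Prop) (E : Fin (d + 1) → Matrix X X ℝ)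
    (hQ : QScheme.IsQPolynomial R E)
    (C : Finset X) (hC : C.Nonempty)
    (hw : ∃ w : Fin (d + 1), (w : ℕ) ≤ d - QScheme.degree R C ∧
      0 < QScheme.dualInnerDistribution E C w ∧
      ∀ k l : Fin (d + 1),
        (k : ℕ) ≤ (w : ℕ) + QScheme.degree R C → (l : ℕ) ≤ (w : ℕ) + QScheme.degree R C →
        ((w : ℕ) : ℤ) + 1 ≤ |((k : ℕ) : ℤ) - ((l : ℕ) : ℤ)| →
        QScheme.restrictedIdempotent E C k * QScheme.restrictedIdempotent E C l = 0) :
    ∃ E' : Fin (QScheme.degree R C + 1) → Matrix {x // x ∈ C} {x // x ∈ C} ℝ,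
      QScheme.IsQPolynomial (QScheme.restrictedRel R C) E' := by
  classical
  obtain ⟨w, hwd, hb, hzero⟩ := hw
  have hR := hQ.isAssociationScheme
  have hI := hQ.isPrimitiveIdempotents
  have hsd : QScheme.degree R C ≤ d := QScheme.degree_le
  have hU := QScheme.restrictedRel_existsUnique (C := C) hR
  have hZ := QScheme.restrictedRel_zero_iff (C := C) hR
  have hS : ∀ i x y, QScheme.restrictedRel R C i x y → QScheme.restrictedRel R C i y x :=
    fun i x y => hR.symm_rel _ _ _
  set F : ℕ → Matrix {x // x ∈ C} {x // x ∈ C} ℝ := fun k =>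
    (QScheme.extendByZero E k).submatrix Subtype.val Subtype.val with hFdef
  have hF : ∀ {k : ℕ} (hk : k ≤ d), F k =
      QScheme.restrictedIdempotent E C ⟨k, Nat.lt_succ_of_le hk⟩ := fun hk => by
    rw [hFdef, QScheme.restrictedIdempotent, ← QScheme.extendByZero_of_le (E := E) hk]
  have hFmem : ∀ k, F k ∈ QScheme.boseMesner (QScheme.restrictedRel R C) := by
    intro k
    rcases le_or_gt k d with hk | hk
    · rw [hF hk]
      exact QScheme.submatrix_mem_boseMesner hR (hI.mem_boseMesner _)
    · simp [hFdef, QScheme.extendByZero_of_lt hk]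
  obtain ⟨G, hG, hG', hidem, horth, hsum⟩ := QScheme.exists_orthogonal_idempotents
    (𝒜 := QScheme.boseMesner (QScheme.restrictedRel R C)) (s := QScheme.degree R C)
    (w := (w : ℕ)) (F := F) QScheme.finrank_boseMesner_le (QScheme.one_mem_boseMesner hZ)
    (fun k _ => hFmem k)
    (fun k => QScheme.transpose_eq_of_mem_boseMesner hS (hFmem k))
    (fun k l hl hkl => by
      rw [hF (show k ≤ d by omega), hF (show l ≤ d by omega)]
      refine hzero _ _ (by simp only; omega) hl ?_
      rw [le_abs]
      right
      simp only
      omega)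
    (fun i hi => by
      rw [hF (show i ≤ d by omega), hF (show (w : ℕ) + i ≤ d by omega)]
      exact hQ.restrictedIdempotent_mul_ne_zero rfl hb)
  have hmem : ∀ i, G i ∈ QScheme.boseMesner (QScheme.restrictedRel R C) := by
    intro i
    refine Submodule.span_le.mpr ?_ (hG i)
    rintro _ ⟨k, -, rfl⟩
    exact hFmem k
  have hne : ∀ i : Fin (QScheme.degree R C + 1), G i ≠ 0 := fun i h0 =>
    hG' i (Nat.lt_succ_iff.mp i.2) (h0 ▸ Submodule.zero_mem _)
  have horth' : ∀ i j : Fin (QScheme.degree R C + 1), i ≠ j → G i * G j = 0 := fun i j hij =>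
    horth i j fun h => hij (Fin.ext h)
  have hcard : (Fintype.card {x // x ∈ C} : ℝ) ≠ 0 := by
    obtain ⟨x, hx⟩ := hC
    exact Nat.cast_ne_zero.mpr (@Fintype.card_ne_zero {x // x ∈ C} _ ⟨⟨x, hx⟩⟩)
  refine ⟨fun i => G i, ⟨hU, QScheme.restrictedRel_nonempty hR hC, hZ, hS, ?_⟩,
    ⟨fun i => hmem i, hne, fun i => hidem i, horth', ?_, ?_⟩, ?_⟩
  · exact QScheme.exists_intersection_numbers_of_mul_mem hU fun i j =>
      QScheme.mul_mem_boseMesner (fun i : Fin _ => hmem i) hne (fun i => hidem i) horth'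
        (Submodule.subset_span ⟨i, rfl⟩) (Submodule.subset_span ⟨j, rfl⟩)
  · rw [← hsum, Finset.sum_range]
  -- `G 0` is a multiple of the restriction of `E 0`, hence constant; being a nonzero idempotent, it
  -- must have entries `1 / |C|`.
  · have hG0 := hG 0
    have hIio : Set.Iio (0 + 1) = {0} := by ext; simp
    rw [hIio, Set.image_singleton, Submodule.mem_span_singleton] at hG0
    obtain ⟨a, ha⟩ := hG0
    have hconst : ∀ x y, G 0 x y = a * (Fintype.card X : ℝ)⁻¹ := fun x y => by
      rw [← ha, Matrix.smul_apply, hF (Nat.zero_le d)]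
      exact congrArg (a * ·) (hI.zero_apply _ _)
    intro x y
    have hxy := congrFun (congrFun (hidem 0) x) y
    rw [Matrix.mul_apply] at hxy
    simp only [hconst, Finset.sum_const, Finset.card_univ, nsmul_eq_mul] at hxy
    have hne0 : a * (Fintype.card X : ℝ)⁻¹ ≠ 0 := by
      intro h0
      apply hne 0
      ext x y
      exact (hconst x y).trans h0
    have : (Fintype.card {x // x ∈ C} : ℝ) * (a * (Fintype.card X : ℝ)⁻¹) = 1 := by
      apply mul_right_cancel₀ hne0
      rw [mul_assoc, hxy, one_mul]
    exact (hconst x y).trans (eq_inv_of_mul_eq_one_right this)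
  · obtain ⟨u, hu, hev⟩ := hQ.exists_degree_eq
    have hev' : ∀ k ≤ d, QScheme.entrywiseEval
        (((Fintype.card X : ℝ) • E 1).submatrix Subtype.val Subtype.val) (u k) = F k :=
      fun k hk => by
        rw [hFdef]
        simp only [← hev k hk]
        rfl
    have hex := fun i : Fin (QScheme.degree R C + 1) =>
      QScheme.exists_entrywiseEval_eq hu hev' (by omega) (hG i)
    choose p hp hpe using hex
    refine QScheme.exists_polynomials_of_entrywiseEval (p := p) (fun i => ?_) hpe hcard
    apply Polynomial.natDegree_eq_of_degree_eq_some
    apply le_antisymm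
    · rw [Polynomial.degree_le_iff_coeff_zero]
      intro k hk
      exact (Polynomial.degree_lt_iff_coeff_zero _ _).mp (hp i) k (by exact_mod_cast hk)
    -- A smaller degree would put `G i` in the span of `F 0, …, F (i-1)`.
    · by_contra hlt
      apply hG' i (Nat.lt_succ_iff.mp i.2)
      rw [← hpe]
      exact QScheme.entrywiseEval_mem_span hu hev' (by omega) (not_le.mp hlt)
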